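/- Let $P_k(w)$ be the $k$-th elementary symmetric polynomial of the eigenvalues of a symmetric $d\times d$ matrix $w$ (and $P_{k,d-1}(\kappa)$ that of $d-1$ numbers $\kappa$), and let $C_m$ be the connected component containing the identity of $\{w \text{ symmetric}: P_m(w)>0\}$. Let $K>0$ and $D\subset\mathbb R^d$. There is a constant $\gamma>0$, depending only on $D$, $K$ and $d$, such that the following holds for every integer $m$ with $2\le m\le d$. Suppose that: * (Domain) $D=\{\psi>0\}$ is a bounded domain with connected boundary, where $\psi\in C^{3,1}(\mathbb R^d)$ and $|\nabla\psi|\ge 1/K$ on $\partial D$, and $D$ is $(m-1)$-convex: $P_{m-1,d-1}(\kappa^1,\dots,\kappa^{d-1})\ge 1/K$ on $\partial D$, where $\kappa^i$ are the principal curvatures of $\partial D$ with respect to the interior normal. * (Right-hand side) $g\in C^1(\bar D)$, $g\ge 0$, the function $g(x)+K|x|^2$ is convex on $\bar D$ (that is, along every line segment contained in $\bar D$), $|\nabla g|^2\le Kg$ in $D$, $\sup_{\bar D}|g|>0$, and $$\operatorname{diam} D+\|g\|_{C^1(\bar D)}+\frac{1}{\sup_{\bar D}|g|}+\|\psi\|_{C^{3,1}(\mathbb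 R^d)}\le K.$$ * (Solution) $u\in C^2(D)\cap C^1(\bar D)$ is $m$-admissible, i.e. $u_{xx}(x)\in\bar C_m$ for all $x\in D$, and solves $$P_m(u_{xx})=g^{m-1}\ \text{ in } D,\qquad u=0\ \text{ on }\partial D.$$ Then at every $x\in\partial D$, with $n$ the inner unit normal of $\partial D$ at $x$, $$D_n u(x)\le-\gamma<0 .$$ -/

import Mathlib

namespace MHessian

/-- Euclidean space of dimension `d`. -/
abbrev E (d : ℕ) : Type := EuclideanSpace ℝ (Fin d)

/-- `P_k(w)`, the `k`-th elementary symmetric polynomial of the eigenvalues of `w`, counted with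
multiplicity. It is only used for symmetric `w`, whose eigenvalues are the `d` real roots of the
characteristic polynomial. -/
noncomputable def P {d : ℕ} (k : ℕ) (w : Matrix (Fin d) (Fin d) ℝ) : ℝ :=
  w.charpoly.roots.esymm k

/-- The cone `C_m`: the connected component containing the identity matrix of the set of
symmetric matrices with `P_m > 0`. -/
noncomputable def gardingCone (d m : ℕ) : Set (Matrix (Fin d) (Fin d) ℝ) :=
  connectedComponentIn {w | w.IsSymm ∧ 0 < P m w} 1

/-- The Hessian matrix `(u_{x^i x^j}(x))`. -/
noncomputable def hessian {d : ℕ} (u : E d → ℝ) (x : E d) : Matrix (Fin d) (Fin d) ℝ :=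
  Matrix.of fun i j =>
    fderiv ℝ (fderiv ℝ u) x (EuclideanSpace.single i 1) (EuclideanSpace.single j 1)

/-- A function of class `C²` in the open set `D` is `m`-admissible if its Hessian matrix lies in
the closure of `C_m` at every point of `D`. -/
def IsAdmissible {d : ℕ} (m : ℕ) (D : Set (E d)) (u : E d → ℝ) : Prop :=
  ContDiffOn ℝ 2 u D ∧ ∀ x ∈ D, hessian u x ∈ closure (gardingCone d m)

/-- The unit normal of the level set of `ψ` through `x` that points into `{ψ > ψ x}`: at a boundary
point of `{ψ > 0}` with `∇ψ ≠ 0` this is the inner normal. -/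
noncomputable def innerNormal {d : ℕ} (ψ : E d → ℝ) (x : E d) : E d :=
  ‖gradient ψ x‖⁻¹ • gradient ψ x

/-- The Weingarten map of the level set of `ψ` through `x` with respect to `innerNormal ψ x`, as an
endomorphism of the tangent hyperplane `(∇ψ x)ᗮ`. With `n = ∇ψ / |∇ψ|`, it is `v ↦ - D_v n`, that
is, `v` goes to the tangential part of `-(D²ψ v) / |∇ψ|`. Spheres, seen from inside, have
positive curvature. -/
noncomputable def weingarten {d : ℕ} (ψ : E d → ℝ) (x : E d) :
    ((ℝ ∙ gradient ψ x)ᗮ : Submodule ℝ (E d)) →ₗ[ℝ] ((ℝ ∙ gradient ψ x)ᗮ : Submodule ℝ (E d)) :=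
  (-‖gradient ψ x‖⁻¹) •
    (((ℝ ∙ gradient ψ x)ᗮ.orthogonalProjectionOnto ∘L fderiv ℝ (gradient ψ) x ∘L
      (ℝ ∙ gradient ψ x)ᗮ.subtypeL :
        ((ℝ ∙ gradient ψ x)ᗮ : Submodule ℝ (E d)) →L[ℝ] ((ℝ ∙ gradient ψ x)ᗮ : Submodule ℝ (E d))) :
      ((ℝ ∙ gradient ψ x)ᗮ : Submodule ℝ (E d)) →ₗ[ℝ] ((ℝ ∙ gradient ψ x)ᗮ : Submodule ℝ (E d)))

/-- The principal curvatures, with multiplicity: the eigenvalues of the (symmetric) Weingarten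
map. -/
noncomputable def principalCurvatures {d : ℕ} (ψ : E d → ℝ) (x : E d) : Multiset ℝ :=
  (weingarten ψ x).charpoly.roots

open scoped ENNReal in
/-- The `C^{3,1}(ℝ^d)` norm of a `C³` function: suprema of the derivatives of order at most three
and the Lipschitz constant of the third derivative. -/
noncomputable def normC31 {d : ℕ} (ψ : E d → ℝ) : ℝ≥0∞ :=
  (∑ k ∈ Finset.range 4, ⨆ x, ‖iteratedFDeriv ℝ k ψ x‖ₑ) +
    ⨆ x, ⨆ y, edist (iteratedFDeriv ℝ 3 ψ x) (iteratedFDeriv ℝ 3 ψ y) / edist x y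

open scoped ENNReal in
/-- The supremum of `|g|` over the closure of `D`. -/
noncomputable def supNorm {d : ℕ} (D : Set (E d)) (g : E d → ℝ) : ℝ≥0∞ :=
  ⨆ x ∈ closure D, ‖g x‖ₑ

open scoped ENNReal in
/-- The `C¹` norm on the closure of the open set `D` of a function that is `C¹` up to the
boundary. -/
noncomputable def normC1 {d : ℕ} (D : Set (E d)) (g : E d → ℝ) : ℝ≥0∞ :=
  supNorm D g + ⨆ x ∈ D, ‖fderiv ℝ g x‖ₑ

/-- `h` is convex on the set `S`, which need not be convex itself: `h` is convex along every line
segment that is contained in `S`. -/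
def ConvexAlongSegments {d : ℕ} (S : Set (E d)) (h : E d → ℝ) : Prop :=
  ∀ x y, segment ℝ x y ⊆ S → ConvexOn ℝ (segment ℝ x y) h

/-- `D = {ψ > 0}` is a bounded domain of class `C^{3,1}` with connected boundary, and it is
`(m-1)`-convex with constant `K`. -/
structure IsConvexDomain {d : ℕ} (m : ℕ) (K : ℝ) (D : Set (E d)) (ψ : E d → ℝ) : Prop where
  eq_pos : D = {x | 0 < ψ x}
  connected : IsConnected D
  bounded : Bornology.IsBounded D
  connected_frontier : IsConnected (frontier D)
  smooth : ContDiff ℝ 3 ψ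
  norm_gradient : ∀ x ∈ frontier D, 1 / K ≤ ‖gradient ψ x‖
  curvature : ∀ x ∈ frontier D, 1 / K ≤ (principalCurvatures ψ x).esymm (m - 1)

/-- The structural assumptions on the right-hand side `g`, together with the joint bound by `K`.
In the bound the reciprocal of `sup |g|` is taken in `[0, ∞]`, so it forces `sup |g| > 0`. -/
structure IsControlled {d : ℕ} (K : ℝ) (D : Set (E d)) (ψ g : E d → ℝ) : Prop where
  smooth : ContDiffOn ℝ 1 g (closure D)
  nonneg : ∀ x ∈ closure D, 0 ≤ g x
  semiconvex : ConvexAlongSegments (closure D) fun x => g x + K * ‖x‖ ^ 2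
  bound : Metric.ediam D + normC1 D g + (supNorm D g)⁻¹ + normC31 ψ ≤ ENNReal.ofReal K
  gradient_sq : ∀ x ∈ D, ‖gradient g x‖ ^ 2 ≤ K * g x

end MHessian

/-! Admissibility makes the trace of the Hessian nonnegative, so the fully nonlinear problem reduces
to Hopf's lemma for subharmonic functions, made quantitative. The algebra enters through Rolle's
theorem: on the closed cone all `P k` with `k ≤ m` are nonnegative, and the first `m` normalized
elementary symmetric functions of the eigenvalues are those of `m` nonnegative numbers. Hence `P m`
is at most a binomial coefficient times the `m`-th power of the trace, and where `g` is bounded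
below the Laplacian of `u` is bounded below.

Since `sup g ≥ 1 / K` and `g` has gradient at most `K`, there is a ball in `D` of radius controlled
by `K` on which `g ≥ 1 / (4 * K)`. A paraboloid there gives `u ≤ -c` on the half ball. Gaussian
barriers in annuli carry this negativity through the connected set `D`, with a factor `κ` made
uniform over all compactly placed starting balls by compactness. Finally the bound on `D²ψ` and
`|∇ψ| ≥ 1 / K` give an interior ball of radius `1 / (2 * K ^ 2)` at each boundary point, where a
last barrier bounds the normal derivative. The factor `κ` depends on the set `D` itself and is not
explicit; no constant depends on `m`, `ψ`, `g` or `u`. -/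

/-! ### Elementary symmetric functions of real numbers -/

open Polynomial in
/-- Rolle's theorem in terms of elementary symmetric functions: the normalized elementary symmetric
functions of `n + 1` real numbers are those of `n` suitable real numbers. -/
theorem Multiset.exists_esymm_div_choose_eq_of_card_succ {n : ℕ} (s : Multiset ℝ)
    (hs : Multiset.card s = n + 1) :
    ∃ t : Multiset ℝ, Multiset.card t = n ∧
      ∀ k ≤ n, s.esymm k / (n + 1).choose k = t.esymm k / n.choose k := by
  set f : ℝ[X] := (s.map fun a => X + C a).prod with hf
  have hcoef : ∀ k ≤ n + 1, f.coeff k = s.esymm (n + 1 - k) := fun k hk => by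
    rw [hf, Multiset.prod_X_add_C_coeff s (by omega), hs]
  have hroots : Multiset.card f.roots = n + 1 := by
    have : f = ((s.map Neg.neg).map fun a => X - C a).prod := by
      rw [hf, Multiset.map_map]; congr 1; apply Multiset.map_congr rfl; intro a _; simp
    rw [this, roots_multiset_prod_X_sub_C, Multiset.card_map, hs]
  have hdeg : f.natDegree ≤ n + 1 := by
    have := natDegree_multiset_prod_le (s.map fun a : ℝ => X + C a)
    rw [Multiset.map_map] at this
    refine this.trans ?_
    rw [Multiset.map_congr rfl (g := fun _ => 1) (fun a _ => by simp)]
    simp [hs, add_comm]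
  set q := derivative f with hq
  have hqc : ∀ k ≤ n, q.coeff k = s.esymm (n - k) * (k + 1) := fun k hk => by
    rw [hq, coeff_derivative, hcoef _ (by omega)]; congr 2; omega
  have hqn : q.coeff n = n + 1 := by rw [hqc n le_rfl]; simp [Multiset.esymm]
  have hqdeg : q.natDegree = n := by
    apply le_antisymm
    · exact (natDegree_derivative_le f).trans (by omega)
    · apply le_natDegree_of_ne_zero; rw [hqn]; positivity
  -- Rolle: passing to the derivative loses at most one real root with multiplicity, so `q` still
  -- splits over the reals.
  have hqr : Multiset.card q.roots = q.natDegree := by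
    apply le_antisymm (card_roots' q)
    have := card_roots_le_derivative f
    rw [← hq] at this
    omega
  refine ⟨q.roots.map Neg.neg, by simp [hqr, hqdeg], fun k hk => ?_⟩
  have h1 := coeff_eq_esymm_roots_of_card hqr (k := n - k) (by omega)
  rw [hqdeg, leadingCoeff, hqdeg, hqn, hqc _ (by omega), mul_assoc] at h1
  rw [Nat.sub_sub_self hk, ← Multiset.esymm_neg, Nat.cast_sub hk] at h1
  have h2 : ((n + 1).choose k : ℝ) * (n + 1 - k) = n.choose k * (n + 1) := by
    have := Nat.choose_mul_succ_eq n k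
    have h3 : ((n + 1 - k : ℕ) : ℝ) = n + 1 - k := by
      rw [Nat.cast_sub (by omega)]; push_cast; ring
    rw [← h3]; exact_mod_cast this.symm
  have h4 : (0 : ℝ) < (n + 1).choose k := by exact_mod_cast Nat.choose_pos (by omega)
  have h5 : (0 : ℝ) < n.choose k := by exact_mod_cast Nat.choose_pos hk
  have h6 : (0 : ℝ) < n + 1 - k := by
    have : (k : ℝ) ≤ n := by exact_mod_cast hk
    linarith
  rw [div_eq_div_iff h4.ne' h5.ne']
  apply mul_right_cancel₀ (b := ((n : ℝ) + 1 - k)) h6.ne'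
  linear_combination ((n.choose k : ℝ)) * h1 - (Multiset.map Neg.neg q.roots).esymm k * h2

theorem Multiset.exists_esymm_div_choose_eq {m n : ℕ} (hmn : m ≤ n) (s : Multiset ℝ)
    (hs : Multiset.card s = n) :
    ∃ t : Multiset ℝ, Multiset.card t = m ∧
      ∀ k ≤ m, s.esymm k / n.choose k = t.esymm k / m.choose k := by
  induction n, hmn using Nat.le_induction generalizing s with
  | base => exact ⟨s, hs, fun k _ => rfl⟩
  | succ n hn ih =>
    obtain ⟨t, ht, h⟩ := s.exists_esymm_div_choose_eq_of_card_succ hs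
    obtain ⟨r, hr, h'⟩ := ih t ht
    exact ⟨r, hr, fun k hk => (h k (hk.trans hn)).trans (h' k hk)⟩

open Polynomial in
-- A negative `a` would make the positive number `-a` a root of `∏ (X + a)`, a monic polynomial with
-- nonnegative coefficients.
theorem Multiset.nonneg_of_esymm_nonneg (t : Multiset ℝ)
    (h : ∀ k ≤ Multiset.card t, 0 ≤ t.esymm k) : ∀ a ∈ t, 0 ≤ a := by
  intro a ha
  by_contra! hneg
  have h1 : ((t.map fun a => X + C a).prod).eval (-a) = 0 := by
    rw [eval_multiset_prod, Multiset.prod_eq_zero_iff, Multiset.map_map]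
    exact Multiset.mem_map.2 ⟨a, ha, by simp⟩
  rw [Multiset.prod_X_add_C_eq_sum_esymm, eval_finsetSum] at h1
  have h2 : 0 < ∑ j ∈ Finset.range (Multiset.card t + 1),
      eval (-a) (C (t.esymm j) * X ^ (Multiset.card t - j)) := by
    apply Finset.sum_pos'
    · intro j hj
      have := h j (by simpa [Nat.lt_succ_iff] using hj)
      simp only [eval_mul, eval_C, eval_pow, eval_X]
      have : 0 ≤ -a := by linarith
      positivity
    · refine ⟨0, by simp, ?_⟩
      have : 0 < -a := by linarith
      have h0 : t.esymm 0 = 1 := by simp [Multiset.esymm]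
      simp only [eval_mul, eval_C, eval_pow, eval_X, h0]
      positivity
  exact h2.ne' h1

theorem Multiset.esymm_pos {t : Multiset ℝ} (h : ∀ a ∈ t, 0 < a) {k : ℕ}
    (hk : k ≤ Multiset.card t) : 0 < t.esymm k := by
  rw [Multiset.esymm]
  have hne : Multiset.map Multiset.prod (Multiset.powersetCard k t) ≠ 0 := by
    rw [← Multiset.card_pos, Multiset.card_map, Multiset.card_powersetCard]
    exact Nat.choose_pos hk
  have hp : ∀ x ∈ Multiset.map Multiset.prod (Multiset.powersetCard k t), 0 < x := by
    intro x hx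
    obtain ⟨r, hr, rfl⟩ := Multiset.mem_map.1 hx
    have hr' := (Multiset.mem_powersetCard.1 hr).1
    exact Multiset.prod_induction (fun x : ℝ => 0 < x) r (fun a b ha hb => mul_pos ha hb) one_pos
      fun a ha => h a (Multiset.mem_of_le hr' ha)
  obtain ⟨x, hx⟩ := Multiset.exists_mem_of_ne_zero hne
  exact (hp x hx).trans_le (Multiset.single_le_sum (fun y hy => (hp y hy).le) x hx)

/-- Rolle reduces to exactly `m` numbers: they are nonnegative and their product is positive, so
each is positive. This is the closedness step in the connectedness argument for the cone. -/
theorem Multiset.esymm_pos_of_nonneg_of_pos {m : ℕ} {s : Multiset ℝ} (hm : m ≤ Multiset.card s)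
    (h : ∀ k ≤ m, 0 ≤ s.esymm k) (hpos : 0 < s.esymm m) : ∀ k ≤ m, 0 < s.esymm k := by
  obtain ⟨t, ht, hst⟩ := s.exists_esymm_div_choose_eq hm rfl
  have hc : ∀ k ≤ m, (0 : ℝ) < (Multiset.card s).choose k := fun k hk => by
    exact_mod_cast Nat.choose_pos (hk.trans hm)
  have hc' : ∀ k ≤ m, (0 : ℝ) < m.choose k := fun k hk => by
    exact_mod_cast Nat.choose_pos hk
  have h1 : ∀ a ∈ t, 0 ≤ a := t.nonneg_of_esymm_nonneg fun k hk => by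
    rw [ht] at hk
    have h2 : 0 ≤ t.esymm k / m.choose k := hst k hk ▸ div_nonneg (h k hk) (hc k hk).le
    have := mul_nonneg h2 (hc' k hk).le
    rwa [div_mul_cancel₀ _ (hc' k hk).ne'] at this
  have h3 : 0 < t.prod := by
    have h2 : 0 < t.esymm m / m.choose m := hst m le_rfl ▸ div_pos hpos (hc m le_rfl)
    rw [Nat.choose_self, Nat.cast_one, div_one] at h2
    have h5 : t.esymm m = t.prod := by
      rw [← ht, Multiset.esymm, Multiset.powersetCard_self]; simp
    rwa [h5] at h2
  have h4 : ∀ a ∈ t, 0 < a := fun a ha => lt_of_le_of_ne (h1 a ha) fun h0 =>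
    h3.ne' (Multiset.prod_eq_zero (h0 ▸ ha))
  intro k hk
  have h2 : 0 < s.esymm k / (Multiset.card s).choose k :=
    hst k hk ▸ div_pos (Multiset.esymm_pos h4 (ht ▸ hk)) (hc' k hk)
  have := mul_pos h2 (hc k hk)
  rwa [div_mul_cancel₀ _ (hc k hk).ne'] at this

/-- A crude form of Maclaurin's inequality. -/
theorem Multiset.esymm_le_choose_mul_sum_pow {m : ℕ} {s : Multiset ℝ} (h1m : 1 ≤ m)
    (hm : m ≤ Multiset.card s) (h : ∀ k ≤ m, 0 ≤ s.esymm k) :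
    s.esymm m ≤ (Multiset.card s).choose m * s.sum ^ m := by
  obtain ⟨t, ht, hst⟩ := s.exists_esymm_div_choose_eq hm rfl
  have hc : ∀ k ≤ m, (0 : ℝ) < (Multiset.card s).choose k := fun k hk => by
    exact_mod_cast Nat.choose_pos (hk.trans hm)
  have hc' : ∀ k ≤ m, (0 : ℝ) < m.choose k := fun k hk => by
    exact_mod_cast Nat.choose_pos hk
  have h1 : ∀ a ∈ t, 0 ≤ a := t.nonneg_of_esymm_nonneg fun k hk => by
    rw [ht] at hk
    have h2 : 0 ≤ t.esymm k / m.choose k := hst k hk ▸ div_nonneg (h k hk) (hc k hk).le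
    have := mul_nonneg h2 (hc' k hk).le
    rwa [div_mul_cancel₀ _ (hc' k hk).ne'] at this
  have hsum : ∀ r : Multiset ℝ, r.esymm 1 = r.sum := fun r => by
    simp [Multiset.esymm, Multiset.powersetCard_one]
  have h5 : t.esymm m = t.prod := by
    rw [← ht, Multiset.esymm, Multiset.powersetCard_self]; simp
  have hcard : (1 : ℝ) ≤ Multiset.card s := by exact_mod_cast h1m.trans hm
  have hmcard : (m : ℝ) ≤ Multiset.card s := by exact_mod_cast hm
  have hm0 : (0 : ℝ) < m := by exact_mod_cast h1m
  have hs0 : 0 ≤ s.sum := hsum s ▸ h 1 h1m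
  -- The two multisets have the same mean and `t` has no more elements.
  have h6 : t.sum ≤ s.sum := by
    have := hst 1 h1m
    rw [hsum, hsum, Nat.choose_one_right, Nat.choose_one_right, eq_div_iff hm0.ne'] at this
    rw [← this, div_mul_eq_mul_div, div_le_iff₀ (by linarith)]
    gcongr
  have h7 : t.prod ≤ s.sum ^ m := by
    have := Multiset.prod_map_le_prod_map₀ (s := t) id (fun _ => s.sum) (fun a ha => h1 a ha)
      (fun a ha => (Multiset.single_le_sum h1 a ha).trans h6)
    simpa [ht] using this
  have h8 := hst m le_rfl
  rw [Nat.choose_self, Nat.cast_one, div_one, h5, div_eq_iff (hc m le_rfl).ne'] at h8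
  rw [h8, mul_comm]
  exact mul_le_mul_of_nonneg_left h7 (hc m le_rfl).le

/-! ### The Gårding cone and the trace -/

namespace MHessian

variable {d m : ℕ}

theorem isHermitian_of_isSymm {w : Matrix (Fin d) (Fin d) ℝ} (hw : w.IsSymm) : w.IsHermitian := by
  rw [Matrix.IsHermitian, Matrix.conjTranspose_eq_transpose_of_trivial]; exact hw

theorem card_roots_charpoly {w : Matrix (Fin d) (Fin d) ℝ} (hw : w.IsSymm) :
    Multiset.card w.charpoly.roots = d := by
  have := Polynomial.splits_iff_card_roots.1 (isHermitian_of_isSymm hw).splits_charpoly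
  rw [this]; simp

/-- The coefficient of the characteristic polynomial that equals `P k` on symmetric matrices. -/
noncomputable def charCoeff (k : ℕ) (w : Matrix (Fin d) (Fin d) ℝ) : ℝ :=
  (-1) ^ k * w.charpoly.coeff (d - k)

/-- Each coefficient is a polynomial in the matrix entries, by specializing the universal
characteristic polynomial. -/
theorem continuous_charCoeff (k : ℕ) :
    Continuous (charCoeff k : Matrix (Fin d) (Fin d) ℝ → ℝ) := by
  refine continuous_const.mul ?_
  have h : ∀ w : Matrix (Fin d) (Fin d) ℝ, w.charpoly.coeff (d - k) =
      MvPolynomial.eval (fun p : Fin d × Fin d => w p.1 p.2)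
        ((Matrix.charpoly.univ ℝ (Fin d)).coeff (d - k)) := fun w => by
    have := Matrix.charpoly.univ_coeff_eval₂Hom (n := Fin d) (RingHom.id ℝ)
      (fun p : Fin d × Fin d => w p.1 p.2) (d - k)
    exact this.symm
  simp_rw [h]
  refine (MvPolynomial.continuous_eval _).comp ?_
  fun_prop

theorem P_eq_charCoeff {w : Matrix (Fin d) (Fin d) ℝ} (hw : w.IsSymm) {k : ℕ} (hk : k ≤ d) :
    P k w = charCoeff k w := by
  have h1 : Multiset.card w.charpoly.roots = w.charpoly.natDegree := by
    rw [card_roots_charpoly hw]; simp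
  have h2 := Polynomial.coeff_eq_esymm_roots_of_card h1 (k := d - k) (by simp)
  have h3 : w.charpoly.natDegree - (d - k) = k := by simp; omega
  rw [h3, (Matrix.charpoly_monic w).leadingCoeff, one_mul] at h2
  rw [charCoeff, h2, ← mul_assoc, ← mul_pow]
  simp [P]

/-- Positivity of all `charCoeff k` with `k ≤ m` is an open condition containing the identity.
Within `P m > 0` it is also closed, since a limit has nonnegative symmetric functions with positive
top one. Hence it holds on the whole component. -/
theorem gardingCone_subset (hmd : m ≤ d) :
    gardingCone d m ⊆ {w | w.IsSymm ∧ ∀ k ≤ m, 0 < P k w} := by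
  set S : Set (Matrix (Fin d) (Fin d) ℝ) := {w | w.IsSymm ∧ 0 < P m w} with hS
  have hsub : gardingCone d m ⊆ S := connectedComponentIn_subset _ _
  set U : Set (Matrix (Fin d) (Fin d) ℝ) := {w | ∀ k ≤ m, 0 < charCoeff k w} with hU
  have hUo : IsOpen U := by
    have : U = ⋂ k ∈ Finset.range (m + 1), {w | 0 < charCoeff k w} := by
      ext w; simp [hU]
    rw [this]
    exact isOpen_biInter_finset fun k _ => isOpen_lt continuous_const (continuous_charCoeff k)
  have hone : ∀ k ≤ m, 0 < P k (1 : Matrix (Fin d) (Fin d) ℝ) := fun k hk => by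
    refine Multiset.esymm_pos ?_ ?_
    · intro a ha
      rw [Matrix.charpoly_one] at ha
      have : a - 1 = 0 := by
        have h := Polynomial.isRoot_of_mem_roots ha
        rw [Polynomial.IsRoot, Polynomial.eval_pow] at h
        simpa using eq_zero_of_pow_eq_zero h
      linarith
    · rw [card_roots_charpoly Matrix.isSymm_one]; omega
  have h1S : (1 : Matrix (Fin d) (Fin d) ℝ) ∈ S := ⟨Matrix.isSymm_one, hone m le_rfl⟩
  have hmain : gardingCone d m ⊆ U := by
    refine isPreconnected_connectedComponentIn.subset_of_closure_inter_subset hUo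
      ⟨1, mem_connectedComponentIn h1S, fun k hk => ?_⟩ ?_
    · rw [← P_eq_charCoeff Matrix.isSymm_one (hk.trans hmd)]; exact hone k hk
    · rintro w ⟨hwU, hw⟩ k hk
      obtain ⟨hws, hwm⟩ := hsub hw
      have hcl : ∀ k ≤ m, 0 ≤ P k w := fun k hk => by
        rw [P_eq_charCoeff hws (hk.trans hmd)]
        have hc : IsClosed {w : Matrix (Fin d) (Fin d) ℝ | 0 ≤ charCoeff k w} :=
          isClosed_le continuous_const (continuous_charCoeff k)
        exact closure_minimal (fun v hv => (hv k hk).le) hc hwU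
      rw [← P_eq_charCoeff hws (hk.trans hmd)]
      exact Multiset.esymm_pos_of_nonneg_of_pos (by rw [card_roots_charpoly hws]; exact hmd)
        hcl hwm k hk
  intro w hw
  refine ⟨(hsub hw).1, fun k hk => ?_⟩
  rw [P_eq_charCoeff (hsub hw).1 (hk.trans hmd)]
  exact hmain hw k hk

theorem closure_gardingCone_subset (hmd : m ≤ d) :
    closure (gardingCone d m) ⊆ {w | w.IsSymm ∧ ∀ k ≤ m, 0 ≤ P k w} := by
  have hc : IsClosed {w : Matrix (Fin d) (Fin d) ℝ | w.IsSymm ∧ ∀ k ≤ m, 0 ≤ charCoeff k w} := by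
    have : {w : Matrix (Fin d) (Fin d) ℝ | w.IsSymm ∧ ∀ k ≤ m, 0 ≤ charCoeff k w} =
        {w | w.transpose = w} ∩ ⋂ k ∈ Finset.range (m + 1), {w | 0 ≤ charCoeff k w} := by
      ext w; simp [Matrix.IsSymm]
    rw [this]
    exact (isClosed_eq (by fun_prop) continuous_id).inter
      (isClosed_biInter fun k _ => isClosed_le continuous_const (continuous_charCoeff k))
  intro w hw
  have h := closure_minimal (t := {w : Matrix (Fin d) (Fin d) ℝ | w.IsSymm ∧
    ∀ k ≤ m, 0 ≤ charCoeff k w}) (fun v hv => by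
      obtain ⟨h1, h2⟩ := gardingCone_subset hmd hv
      exact ⟨h1, fun k hk => P_eq_charCoeff h1 (hk.trans hmd) ▸ (h2 k hk).le⟩) hc hw
  exact ⟨h.1, fun k hk => (P_eq_charCoeff h.1 (hk.trans hmd)).symm ▸ h.2 k hk⟩

theorem P_one_eq_trace {w : Matrix (Fin d) (Fin d) ℝ} (hw : w.IsSymm) : P 1 w = w.trace := by
  rw [Matrix.trace_eq_sum_roots_charpoly_of_splits (isHermitian_of_isSymm hw).splits_charpoly]
  simp [P, Multiset.esymm, Multiset.powersetCard_one]

theorem trace_nonneg_of_mem_closure_gardingCone (h1m : 1 ≤ m) (hmd : m ≤ d)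
    {w : Matrix (Fin d) (Fin d) ℝ} (hw : w ∈ closure (gardingCone d m)) : 0 ≤ w.trace := by
  obtain ⟨h1, h2⟩ := closure_gardingCone_subset hmd hw
  exact P_one_eq_trace h1 ▸ h2 1 h1m

theorem P_le_trace_pow (h1m : 1 ≤ m) (hmd : m ≤ d)
    {w : Matrix (Fin d) (Fin d) ℝ} (hw : w ∈ closure (gardingCone d m)) :
    P m w ≤ d.choose m * w.trace ^ m := by
  obtain ⟨h1, h2⟩ := closure_gardingCone_subset hmd hw
  have h := Multiset.esymm_le_choose_mul_sum_pow (s := w.charpoly.roots) h1m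
    (by rw [card_roots_charpoly h1]; exact hmd) h2
  rwa [card_roots_charpoly h1,
    ← Matrix.trace_eq_sum_roots_charpoly_of_splits (isHermitian_of_isSymm h1).splits_charpoly] at h

/-- A lower bound for the trace of a matrix in the closed cone in terms of a lower bound `a` for
the `(m-1)`-st root of `P m`, uniform in `m`. -/
theorem le_trace_of_pow_le (h1m : 1 ≤ m) (hmd : m ≤ d) {a : ℝ} (ha : 0 < a) (ha1 : a ≤ 1)
    {w : Matrix (Fin d) (Fin d) ℝ} (hw : w ∈ closure (gardingCone d m))
    (h : a ^ (m - 1) ≤ P m w) : a ^ d / 2 ^ d ≤ w.trace := by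
  have h0 := trace_nonneg_of_mem_closure_gardingCone h1m hmd hw
  have h1 := P_le_trace_pow h1m hmd hw
  have hq1 : a ^ d / 2 ^ d ≤ 1 := by
    rw [← div_pow]; exact pow_le_one₀ (by positivity) (by linarith)
  -- A trace below the bound is at most one, so its `m`-th power is at most the trace itself.
  -- Replacing `m - 1` by `d` and the binomial coefficient by `2 ^ d` removes the dependence on `m`.
  by_contra! hlt
  have h2 : w.trace ^ m ≤ w.trace := pow_le_of_le_one h0 (by linarith) (by omega)
  have h3 : (d.choose m : ℝ) ≤ 2 ^ d := by exact_mod_cast Nat.choose_le_two_pow d m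
  have h4 : a ^ d ≤ a ^ (m - 1) := pow_le_pow_of_le_one ha.le ha1 (by omega)
  have h5 : (d.choose m : ℝ) * w.trace ^ m ≤ 2 ^ d * w.trace := by gcongr
  rw [lt_div_iff₀ (by positivity)] at hlt
  linarith

end MHessian

/-! ### Second derivatives and the maximum principle -/

open Filter Topology in
/-- The second derivative of a function of one variable is nonpositive at a local maximum. -/
theorem IsLocalMax.second_deriv_nonpos {φ φ' : ℝ → ℝ} {a c : ℝ} (h : IsLocalMax φ a)
    (h1 : ∀ᶠ t in 𝓝 a, HasDerivAt φ (φ' t) t) (h2 : HasDerivAt φ' c a) : c ≤ 0 := by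
  by_contra! hc
  have e1 : deriv φ =ᶠ[𝓝 a] φ' := h1.mono fun t ht => ht.deriv
  have e2 : deriv (deriv φ) a = c := e1.deriv_eq.trans h2.deriv
  -- If `c > 0`, the point is also a local minimum, so `φ` is locally constant and its second
  -- derivative vanishes.
  have hmin : IsLocalMin φ a := isLocalMin_of_deriv_deriv_pos (by rw [e2]; exact hc)
    h.deriv_eq_zero h1.self_of_nhds.continuousAt
  have e3 : φ =ᶠ[𝓝 a] fun _ => φ a := by
    filter_upwards [h, hmin] with t ht ht' using le_antisymm ht ht'
  have e4 : deriv φ =ᶠ[𝓝 a] fun _ => 0 := by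
    have := e3.deriv; simpa using this
  have e5 := e4.deriv_eq
  rw [e2] at e5
  simp at e5
  exact hc.ne' e5

namespace MHessian

open Filter Topology Metric

section Lines

variable {V : Type*} [NormedAddCommGroup V] [NormedSpace ℝ V] {v : V → ℝ} {x : V}

theorem hasDerivAt_line (x e : V) (t : ℝ) : HasDerivAt (fun t : ℝ => x + t • e) e t := by
  simpa using ((hasDerivAt_id t).smul_const e).const_add x

theorem eventually_hasDerivAt_comp_line (hv : ContDiffAt ℝ 2 v x) (e : V) :
    ∀ᶠ t in 𝓝 (0 : ℝ),
      HasDerivAt (fun t : ℝ => v (x + t • e)) (fderiv ℝ v (x + t • e) e) t := by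
  have h1 : ∀ᶠ y in 𝓝 x, ContDiffAt ℝ 2 v y := hv.eventually (by simp)
  have h2 : Tendsto (fun t : ℝ => x + t • e) (𝓝 0) (𝓝 x) := by
    have : ContinuousAt (fun t : ℝ => x + t • e) 0 := (hasDerivAt_line x e 0).continuousAt
    simpa [ContinuousAt] using this
  filter_upwards [h2.eventually h1] with t ht
  exact (ht.differentiableAt (by norm_num)).hasFDerivAt.comp_hasDerivAt t (hasDerivAt_line x e t)

theorem hasDerivAt_fderiv_comp_line (hv : ContDiffAt ℝ 2 v x) (e : V) :
    HasDerivAt (fun t : ℝ => fderiv ℝ v (x + t • e) e) (fderiv ℝ (fderiv ℝ v) x e e) 0 := by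
  have h1 : DifferentiableAt ℝ (fderiv ℝ v) x :=
    (hv.fderiv_right (m := 1) (by norm_num)).differentiableAt (by norm_num)
  have h2 : HasDerivAt (fun t : ℝ => fderiv ℝ v (x + t • e)) (fderiv ℝ (fderiv ℝ v) x e) 0 :=
    HasFDerivAt.comp_hasDerivAt_of_eq (0 : ℝ) h1.hasFDerivAt (hasDerivAt_line x e 0) (by simp)
  simpa using h2.clm_apply (hasDerivAt_const (0 : ℝ) e)

theorem fderiv_fderiv_apply_nonpos_of_isLocalMax (hv : ContDiffAt ℝ 2 v x) (h : IsLocalMax v x)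
    (e : V) : fderiv ℝ (fderiv ℝ v) x e e ≤ 0 := by
  refine IsLocalMax.second_deriv_nonpos (a := 0) (φ := fun t : ℝ => v (x + t • e)) ?_
    (eventually_hasDerivAt_comp_line hv e) (hasDerivAt_fderiv_comp_line hv e)
  have : ContinuousAt (fun t : ℝ => x + t • e) 0 := (hasDerivAt_line x e 0).continuousAt
  have h2 : Tendsto (fun t : ℝ => x + t • e) (𝓝 0) (𝓝 x) := by simpa [ContinuousAt] using this
  simpa [IsLocalMax, IsMaxFilter] using h2.eventually h

/-- Reduces diagonal Hessian entries of explicit barriers to one-variable calculus. -/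
theorem fderiv_fderiv_apply_eq (hv : ContDiffAt ℝ 2 v x) (e : V) {φ' : ℝ → ℝ} {c : ℝ}
    (h1 : ∀ t, HasDerivAt (fun t : ℝ => v (x + t • e)) (φ' t) t) (h2 : HasDerivAt φ' c 0) :
    fderiv ℝ (fderiv ℝ v) x e e = c := by
  refine HasDerivAt.unique (hasDerivAt_fderiv_comp_line hv e) (h2.congr_of_eventuallyEq ?_)
  filter_upwards [eventually_hasDerivAt_comp_line hv e] with t ht using ht.unique (h1 t)

end Lines

variable {d : ℕ}

theorem trace_hessian (u : E d → ℝ) (x : E d) :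
    (hessian u x).trace = ∑ i, fderiv ℝ (fderiv ℝ u) x (EuclideanSpace.single i 1)
      (EuclideanSpace.single i 1) := rfl

theorem trace_hessian_nonpos_of_isLocalMax {v : E d → ℝ} {x : E d} (hv : ContDiffAt ℝ 2 v x)
    (h : IsLocalMax v x) : (hessian v x).trace ≤ 0 :=
  Finset.sum_nonpos fun _ _ => fderiv_fderiv_apply_nonpos_of_isLocalMax hv h _

theorem trace_hessian_add_const_mul {u h : E d → ℝ} {x : E d} (hu : ContDiffAt ℝ 2 u x)
    (hh : ContDiffAt ℝ 2 h x) (c : ℝ) :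
    (hessian (fun y => u y + c * h y) x).trace = (hessian u x).trace + c * (hessian h x).trace := by
  have hd : ∀ᶠ y in 𝓝 x, fderiv ℝ (fun y => u y + c * h y) y = fderiv ℝ u y + c • fderiv ℝ h y := by
    filter_upwards [hu.eventually (by simp), hh.eventually (by simp)] with y h1 h2
    have h1' := (h1.differentiableAt (by norm_num)).hasFDerivAt
    have h2' := (h2.differentiableAt (by norm_num)).hasFDerivAt
    exact (h1'.add (h2'.const_mul c)).fderiv
  have h1 : DifferentiableAt ℝ (fderiv ℝ u) x :=
    (hu.fderiv_right (m := 1) (by norm_num)).differentiableAt (by norm_num)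
  have h2 : DifferentiableAt ℝ (fderiv ℝ h) x :=
    (hh.fderiv_right (m := 1) (by norm_num)).differentiableAt (by norm_num)
  have h3 : fderiv ℝ (fderiv ℝ (fun y => u y + c * h y)) x =
      fderiv ℝ (fderiv ℝ u) x + c • fderiv ℝ (fderiv ℝ h) x := by
    have hd' : fderiv ℝ (fun y => u y + c * h y) =ᶠ[𝓝 x] fderiv ℝ u + c • fderiv ℝ h := hd
    rw [hd'.fderiv_eq]
    exact (h1.hasFDerivAt.add (h2.hasFDerivAt.const_smul c)).fderiv
  simp only [trace_hessian, h3]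
  simp [Finset.sum_add_distrib, Finset.mul_sum]

/-- The maximum principle for strictly subharmonic functions. -/
theorem le_of_trace_hessian_pos {S Ω : Set (E d)} {v : E d → ℝ} {M : ℝ} (hS : IsCompact S)
    (hΩ : IsOpen Ω) (hΩS : Ω ⊆ S) (hc : ContinuousOn v S) (hv : ContDiffOn ℝ 2 v Ω)
    (hpos : ∀ x ∈ Ω, 0 < (hessian v x).trace) (hM : ∀ x ∈ S, x ∉ Ω → v x ≤ M) :
    ∀ x ∈ S, v x ≤ M := by
  intro x hx
  obtain ⟨y, hy, hmax⟩ := hS.exists_isMaxOn ⟨x, hx⟩ hc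
  refine (hmax hx).trans (hM y hy fun hyΩ => ?_)
  have hn := hΩ.mem_nhds hyΩ
  refine (hpos y hyΩ).not_ge (trace_hessian_nonpos_of_isLocalMax (hv.contDiffAt hn) ?_)
  exact (hmax.on_subset hΩS).isLocalMax hn

theorem norm_sq_line (x z : E d) (i : Fin d) (t : ℝ) :
    ‖x + t • EuclideanSpace.single i (1 : ℝ) - z‖ ^ 2 = ‖x - z‖ ^ 2 + 2 * t * (x - z) i + t ^ 2 := by
  have : x + t • EuclideanSpace.single i (1 : ℝ) - z =
    (x - z) + t • EuclideanSpace.single i (1 : ℝ) := by abel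
  rw [this, norm_add_sq_real, inner_smul_right, norm_smul]
  simp [EuclideanSpace.inner_single_right]
  ring

theorem contDiff_norm_sub_sq (z : E d) : ContDiff ℝ 2 fun y : E d => ‖y - z‖ ^ 2 :=
  (contDiff_id.sub contDiff_const).norm_sq ℝ

theorem contDiff_gaussian (a : ℝ) (z : E d) :
    ContDiff ℝ 2 fun y : E d => Real.exp (-a * ‖y - z‖ ^ 2) :=
  (contDiff_const.mul (contDiff_norm_sub_sq z)).exp

theorem trace_hessian_norm_sub_sq (x z : E d) :
    (hessian (fun y : E d => ‖y - z‖ ^ 2) x).trace = 2 * d := by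
  have : ∀ i : Fin d, fderiv ℝ (fderiv ℝ fun y : E d => ‖y - z‖ ^ 2) x (EuclideanSpace.single i 1)
      (EuclideanSpace.single i 1) = 2 := fun i => by
    refine fderiv_fderiv_apply_eq (contDiff_norm_sub_sq z).contDiffAt _
      (φ' := fun t => 2 * (x - z) i + 2 * t) (fun t => ?_) ?_
    · simp_rw [norm_sq_line]
      have h := (((hasDerivAt_id t).const_mul 2).mul_const ((x - z) i)).const_add (‖x - z‖ ^ 2)
      exact (h.add ((hasDerivAt_id t).pow 2)).congr_deriv (by simp)
    · simpa using ((hasDerivAt_id (0 : ℝ)).const_mul 2).const_add (2 * (x - z) i)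
  rw [trace_hessian, Finset.sum_congr rfl fun i _ => this i]
  simp [mul_comm]

theorem trace_hessian_gaussian (a : ℝ) (x z : E d) :
    (hessian (fun y : E d => Real.exp (-a * ‖y - z‖ ^ 2)) x).trace =
      (4 * a ^ 2 * ‖x - z‖ ^ 2 - 2 * a * d) * Real.exp (-a * ‖x - z‖ ^ 2) := by
  have : ∀ i : Fin d, fderiv ℝ (fderiv ℝ fun y : E d => Real.exp (-a * ‖y - z‖ ^ 2)) x
      (EuclideanSpace.single i 1) (EuclideanSpace.single i 1) =
      (4 * a ^ 2 * (x - z) i ^ 2 - 2 * a) * Real.exp (-a * ‖x - z‖ ^ 2) := fun i => by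
    have hd : ∀ t : ℝ, HasDerivAt
        (fun t : ℝ => Real.exp (-a * (‖x - z‖ ^ 2 + 2 * t * (x - z) i + t ^ 2)))
        (Real.exp (-a * (‖x - z‖ ^ 2 + 2 * t * (x - z) i + t ^ 2)) *
          (-a * (2 * (x - z) i + 2 * t))) t := fun t => by
      have h := (((hasDerivAt_id t).const_mul 2).mul_const ((x - z) i)).const_add (‖x - z‖ ^ 2)
      exact ((h.add ((hasDerivAt_id t).pow 2)).const_mul (-a)).exp.congr_deriv (by simp)
    refine fderiv_fderiv_apply_eq (contDiff_gaussian a z).contDiffAt _ (fun t => ?_) (φ' := fun t =>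
      Real.exp (-a * (‖x - z‖ ^ 2 + 2 * t * (x - z) i + t ^ 2)) *
          (-a * (2 * (x - z) i + 2 * t))) ?_
    · simp_rw [norm_sq_line]
      exact hd t
    · refine ((hd 0).mul ((((hasDerivAt_id (0 : ℝ)).const_mul 2).const_add
        (2 * (x - z) i)).const_mul (-a))).congr_deriv ?_
      simp
      ring
  rw [trace_hessian, Finset.sum_congr rfl fun i _ => this i, ← Finset.sum_mul,
    Finset.sum_sub_distrib, ← Finset.mul_sum, EuclideanSpace.norm_sq_eq]
  simp [mul_comm]

/-! ### Barriers and the Hopf lemma for subharmonic functions -/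

/-- Nonpositive subharmonic functions of class `C²` in `D`, continuous up to the boundary. -/
structure IsNonposSubharmonic (D : Set (E d)) (u : E d → ℝ) : Prop where
  continuousOn : ContinuousOn u (closure D)
  contDiffOn : ContDiffOn ℝ 2 u D
  trace_nonneg : ∀ x ∈ D, 0 ≤ (hessian u x).trace
  nonpos : ∀ x ∈ closure D, u x ≤ 0

/-- Adding `ε * ‖y‖ ^ 2` makes the function strictly subharmonic and raises the boundary values by
at most `ε * R ^ 2`; then `ε` is taken small. -/
theorem isNonposSubharmonic_of_frontier [NeZero d] {D : Set (E d)} {u : E d → ℝ} (hD : IsOpen D)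
    (hb : Bornology.IsBounded D) (hc : ContinuousOn u (closure D)) (hu : ContDiffOn ℝ 2 u D)
    (htr : ∀ x ∈ D, 0 ≤ (hessian u x).trace) (hf : ∀ x ∈ frontier D, u x = 0) :
    IsNonposSubharmonic D u := by
  refine ⟨hc, hu, htr, fun x hx => ?_⟩
  have hcomp : IsCompact (closure D) := hb.isCompact_closure
  obtain ⟨R, hR⟩ := hb.closure.subset_closedBall (0 : E d)
  have hdpos : (0 : ℝ) < d := by exact_mod_cast Nat.pos_of_ne_zero (NeZero.ne d)
  have key : ∀ ε > 0, u x ≤ ε * R ^ 2 := fun ε hε => by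
    have hq := contDiff_norm_sub_sq (0 : E d)
    have := le_of_trace_hessian_pos (v := fun y => u y + ε * ‖y - 0‖ ^ 2) (M := ε * R ^ 2)
      hcomp hD subset_closure (hc.add (hq.continuous.continuousOn.const_mul ε |>.congr fun _ _ => rfl))
      (hu.add (contDiffOn_const.mul hq.contDiffOn)) (fun y hy => ?_) (fun y hy hyD => ?_) x hx
    · have : 0 ≤ ε * ‖x - 0‖ ^ 2 := by positivity
      linarith
    · rw [trace_hessian_add_const_mul (hu.contDiffAt (hD.mem_nhds hy)) hq.contDiffAt,
        trace_hessian_norm_sub_sq]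
      have := htr y hy
      positivity
    · have hyf : y ∈ frontier D := by rw [hD.frontier_eq]; exact ⟨hy, hyD⟩
      simp only [hf y hyf, zero_add]
      have h1 := hR hy
      rw [mem_closedBall, dist_eq_norm] at h1
      gcongr
  by_contra! hpos
  have h1 := key (u x / (2 * (R ^ 2 + 1))) (by positivity)
  rw [div_mul_eq_mul_div, le_div_iff₀ (by positivity)] at h1
  nlinarith [sq_nonneg R]

namespace IsNonposSubharmonic

variable {D : Set (E d)} {u : E d → ℝ}

theorem closedBall_subset {z : E d} {R : ℝ} (hR : R ≠ 0) (hball : ball z R ⊆ D) :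
    closedBall z R ⊆ closure D :=
  closure_ball z hR ▸ closure_mono hball

/-- Comparison with a Gaussian barrier in an annulus. -/
theorem le_barrier [NeZero d] (h : IsNonposSubharmonic D u) {z : E d} {s R c : ℝ} (hs : 0 < s)
    (hsR : s < R) (hball : ball z R ⊆ D) (hc : 0 < c) (hu : ∀ y ∈ closedBall z s, u y ≤ -c)
    {y : E d} (hys : s ≤ ‖y - z‖) (hyR : ‖y - z‖ ≤ R) :
    u y ≤ -(c * (Real.exp (-(d / s ^ 2) * ‖y - z‖ ^ 2) - Real.exp (-(d / s ^ 2) * R ^ 2))) := by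
  have hdpos : (0 : ℝ) < d := by exact_mod_cast Nat.pos_of_ne_zero (NeZero.ne d)
  -- The Laplacian of the Gaussian has the sign of `2 * a * ‖y - z‖ ^ 2 - d`; with `a * s ^ 2 = d`
  -- it is positive outside the inner ball.
  set a : ℝ := d / s ^ 2 with ha
  have hapos : 0 < a := by positivity
  set S : Set (E d) := {y | s ≤ ‖y - z‖ ∧ ‖y - z‖ ≤ R} with hS
  set Ω : Set (E d) := {y | s < ‖y - z‖ ∧ ‖y - z‖ < R} with hΩ
  have hcn : Continuous fun y : E d => ‖y - z‖ := by fun_prop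
  have hSball : S ⊆ closedBall z R := fun w hw => by
    rw [mem_closedBall, dist_eq_norm]; exact hw.2
  have hScl : IsClosed S := (isClosed_le continuous_const hcn).inter (isClosed_le hcn continuous_const)
  have hScomp : IsCompact S := (isCompact_closedBall z R).of_isClosed_subset hScl hSball
  have hΩo : IsOpen Ω := (isOpen_lt continuous_const hcn).inter (isOpen_lt hcn continuous_const)
  have hΩball : Ω ⊆ ball z R := fun w hw => by
    rw [mem_ball, dist_eq_norm]; exact hw.2
  have hSD : S ⊆ closure D := hSball.trans (closedBall_subset (by linarith) hball)
  have hballo : IsOpen (ball z R) := isOpen_ball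
  have hg := contDiff_gaussian a z
  have hexp : ∀ {p q : ℝ}, 0 ≤ p → p ≤ q → Real.exp (-a * q ^ 2) ≤ Real.exp (-a * p ^ 2) := by
    intro p q hp hpq
    apply Real.exp_le_exp.2
    have : p ^ 2 ≤ q ^ 2 := by gcongr
    nlinarith
  have hexp1 : ∀ p : ℝ, Real.exp (-a * p ^ 2) ≤ 1 := fun p => by
    apply Real.exp_le_one_iff.2
    nlinarith [sq_nonneg p]
  have main := le_of_trace_hessian_pos (v := fun y => u y + c * Real.exp (-a * ‖y - z‖ ^ 2))
    (M := c * Real.exp (-a * R ^ 2)) hScomp hΩo (fun w hw => ⟨hw.1.le, hw.2.le⟩)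
    ((h.continuousOn.mono hSD).add (hg.continuous.continuousOn.const_mul c |>.congr fun _ _ => rfl))
    ((h.contDiffOn.mono (hΩball.trans hball)).add (contDiffOn_const.mul hg.contDiffOn))
    (fun w hw => ?_) (fun w hw hwΩ => ?_) y ⟨hys, hyR⟩
  · linarith
  · have hwD : D ∈ 𝓝 w := mem_of_superset (hballo.mem_nhds (hΩball hw)) hball
    rw [trace_hessian_add_const_mul (h.contDiffOn.contDiffAt hwD) hg.contDiffAt,
      trace_hessian_gaussian]
    have h1 := h.trace_nonneg w (mem_of_mem_nhds hwD)
    have h2 : s ^ 2 < ‖w - z‖ ^ 2 := by have := hw.1; gcongr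
    have h3 : a * s ^ 2 = d := by rw [ha]; field_simp
    have h4 : 0 < 4 * a ^ 2 * ‖w - z‖ ^ 2 - 2 * a * d := by
      have : a ^ 2 * s ^ 2 < a ^ 2 * ‖w - z‖ ^ 2 := by gcongr
      have h5 : a ^ 2 * s ^ 2 = a * d := by rw [← h3]; ring
      have : 0 < a * d := by positivity
      nlinarith
    have : 0 < c * ((4 * a ^ 2 * ‖w - z‖ ^ 2 - 2 * a * d) * Real.exp (-a * ‖w - z‖ ^ 2)) := by
      positivity
    linarith
  · have hor : ‖w - z‖ = s ∨ ‖w - z‖ = R := by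
      by_contra! hne
      exact hwΩ ⟨lt_of_le_of_ne hw.1 hne.1.symm, lt_of_le_of_ne hw.2 hne.2⟩
    rcases hor with hw1 | hw1
    · have h1 := hu w (by rw [mem_closedBall, dist_eq_norm, hw1])
      have h2 := hexp1 ‖w - z‖
      have h3 := Real.exp_pos (-a * R ^ 2)
      nlinarith
    · have h1 := h.nonpos w (hSD hw)
      simp only [hw1]
      linarith

/-- Comparison with a paraboloid in a ball where the Laplacian is bounded below. -/
theorem le_paraboloid [NeZero d] (h : IsNonposSubharmonic D u) {z : E d} {R θ : ℝ} (hR : 0 < R)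
    (hball : ball z R ⊆ D) (hθ : 0 < θ) (hu : ∀ y ∈ ball z R, θ ≤ (hessian u y).trace)
    {y : E d} (hy : y ∈ closedBall z R) :
    u y ≤ -(θ / (4 * d) * (R ^ 2 - ‖y - z‖ ^ 2)) := by
  have hdpos : (0 : ℝ) < d := by exact_mod_cast Nat.pos_of_ne_zero (NeZero.ne d)
  have hSD := closedBall_subset hR.ne' hball
  have hg := contDiff_norm_sub_sq z
  -- The paraboloid has Laplacian `θ / 2`, half the available bound, so the difference stays
  -- strictly subharmonic.
  have main := le_of_trace_hessian_pos (v := fun y => u y + (-(θ / (4 * d))) * ‖y - z‖ ^ 2)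
    (M := -(θ / (4 * d)) * R ^ 2) (isCompact_closedBall z R) isOpen_ball ball_subset_closedBall
    ((h.continuousOn.mono hSD).add (hg.continuous.continuousOn.const_mul _ |>.congr fun _ _ => rfl))
    ((h.contDiffOn.mono hball).add (contDiffOn_const.mul hg.contDiffOn))
    (fun w hw => ?_) (fun w hw hwΩ => ?_) y hy
  · linarith
  · have hwD : D ∈ 𝓝 w := mem_of_superset (isOpen_ball.mem_nhds hw) hball
    rw [trace_hessian_add_const_mul (h.contDiffOn.contDiffAt hwD) hg.contDiffAt,
      trace_hessian_norm_sub_sq]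
    have h1 := hu w hw
    have h2 : -(θ / (4 * d)) * (2 * d) = -(θ / 2) := by field_simp; norm_num
    linarith
  · have h1 := h.nonpos w (hSD hw)
    have h2 : ‖w - z‖ = R := by
      rw [mem_closedBall, dist_eq_norm] at hw
      rw [mem_ball, dist_eq_norm, not_lt] at hwΩ
      exact le_antisymm hw hwΩ
    simp only [h2]
    linarith

/-- The Hopf lemma at a boundary point `x` with interior ball `ball (x + r • n) r`. -/
theorem fderivWithin_le [NeZero d] (h : IsNonposSubharmonic D u) {x n : E d} {r c : ℝ} (hr : 0 < r)
    (hn : ‖n‖ = 1) (hball : ball (x + r • n) r ⊆ D) (hc : 0 < c)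
    (hu : ∀ y ∈ closedBall (x + r • n) (r / 2), u y ≤ -c) (hx : u x = 0)
    (hdiff : DifferentiableWithinAt ℝ u (closure D) x) :
    fderivWithin ℝ u (closure D) x n ≤
      -(c * (Real.exp (-(d / (r / 2) ^ 2) * r ^ 2) * (d / (r / 2) ^ 2 * (2 * r)))) := by
  set a : ℝ := d / (r / 2) ^ 2 with ha
  -- Along the inner normal `F ≤ 0` with `F 0 = 0`, so its one-sided derivative at zero is
  -- nonpositive. The barrier annulus has radii `r / 2` and `r`.
  set F : ℝ → ℝ := fun t => u (x + t • n) +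
    c * (Real.exp (-a * (r - t) ^ 2) - Real.exp (-a * r ^ 2)) with hF
  have hnorm : ∀ t, t ≤ r → ‖x + t • n - (x + r • n)‖ = r - t := fun t ht => by
    have : x + t • n - (x + r • n) = (-(r - t)) • n := by module
    rw [this, norm_smul, hn, mul_one, norm_neg, Real.norm_of_nonneg (by linarith)]
  have hle : ∀ t ∈ Set.Icc 0 (r / 2), F t ≤ 0 := fun t ht => by
    have h1 := h.le_barrier (half_pos hr) (by linarith) hball hc hu (y := x + t • n)
      (by rw [hnorm t (by linarith [ht.2])]; linarith [ht.2])
      (by rw [hnorm t (by linarith [ht.2])]; linarith [ht.1])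
    rw [hnorm t (by linarith [ht.2])] at h1
    simp only [hF]
    linarith
  have hmaps : Set.MapsTo (fun t : ℝ => x + t • n) (Set.Icc 0 (r / 2)) (closure D) := fun t ht => by
    refine closedBall_subset hr.ne' hball ?_
    rw [mem_closedBall, dist_eq_norm, hnorm t (by linarith [ht.2])]
    linarith [ht.1]
  have hd1 : HasDerivWithinAt (fun t : ℝ => u (x + t • n)) (fderivWithin ℝ u (closure D) x n)
      (Set.Icc 0 (r / 2)) 0 :=
    HasFDerivWithinAt.comp_hasDerivWithinAt_of_eq (0 : ℝ) hdiff.hasFDerivWithinAt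
      (hasDerivAt_line x n 0).hasDerivWithinAt hmaps (by simp)
  have hd2 : HasDerivAt (fun t : ℝ => c * (Real.exp (-a * (r - t) ^ 2) - Real.exp (-a * r ^ 2)))
      (c * (Real.exp (-a * r ^ 2) * (a * (2 * r)))) 0 := by
    refine ((((((hasDerivAt_id (0 : ℝ)).const_sub r).pow 2).const_mul (-a)).exp.sub_const
      (Real.exp (-a * r ^ 2))).const_mul c).congr_deriv ?_
    simp
  have hd := hd1.add hd2.hasDerivWithinAt
  have hF0 : F 0 = 0 := by simp [hF, hx]
  have hd' : HasDerivWithinAt F (fderivWithin ℝ u (closure D) x n +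
      c * (Real.exp (-a * r ^ 2) * (a * (2 * r)))) (Set.Ioc 0 (r / 2)) 0 :=
    hd.mono Set.Ioc_subset_Icc_self
  rw [hasDerivWithinAt_iff_tendsto_slope' (by simp)] at hd'
  have : (𝓝[Set.Ioc 0 (r / 2)] (0 : ℝ)).NeBot := by
    rw [nhdsWithin_Ioc_eq_nhdsGT (by linarith)]; infer_instance
  have hfin := le_of_tendsto hd' (b := 0) (by
    filter_upwards [self_mem_nhdsWithin] with t ht
    rw [slope_def_field, hF0, sub_zero, sub_zero]
    exact div_nonpos_of_nonpos_of_nonneg (hle t ⟨ht.1.le, ht.2⟩) ht.1.le)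
  linarith

end IsNonposSubharmonic

end MHessian

/-! ### Propagation of negativity inside the domain -/

namespace MHessian

open Filter Topology Metric

variable {d : ℕ} {D : Set (E d)}

namespace IsNonposSubharmonic

/-- Negativity of a nonpositive subharmonic function spreads over a domain: the set of points to
which it spreads with uniform constants from a given ball is open and closed. -/
theorem exists_spread [NeZero d] (hD : IsOpen D) (hconn : IsPreconnected D) {p : E d} (hp : p ∈ D)
    {ρ : ℝ} (hρ : 0 < ρ) {y : E d} (hy : y ∈ D) :
    ∃ κ > 0, ∃ s > 0, ∀ u, IsNonposSubharmonic D u → ∀ c > 0,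
      (∀ w ∈ closedBall p ρ, u w ≤ -c) → ∀ w ∈ ball y s, u w ≤ -(κ * c) := by
  have hdpos : (0 : ℝ) < d := by exact_mod_cast Nat.pos_of_ne_zero (NeZero.ne d)
  let A : Set (E d) := {y | ∃ κ > 0, ∃ s > 0, ∀ u, IsNonposSubharmonic D u → ∀ c > 0,
      (∀ w ∈ closedBall p ρ, u w ≤ -c) → ∀ w ∈ ball y s, u w ≤ -(κ * c)}
  have hAo : IsOpen A := by
    refine Metric.isOpen_iff.2 fun y ⟨κ, hκ, s, hs, h⟩ => ⟨s / 2, half_pos hs, fun y' hy' => ?_⟩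
    refine ⟨κ, hκ, s / 2, half_pos hs, fun u hu c hc hcu w hw => h u hu c hc hcu w ?_⟩
    rw [mem_ball] at *
    linarith [dist_triangle w y' y]
  refine hconn.subset_of_closure_inter_subset hAo ⟨p, hp, 1, one_pos, ρ, hρ,
    fun u _ c _ h w hw => ?_⟩ ?_ hy
  · rw [one_mul]
    exact h w (ball_subset_closedBall hw)
  rintro y ⟨hyA, hyD⟩
  obtain ⟨R₀, hR₀, hR⟩ := Metric.isOpen_iff.1 hD y hyD
  obtain ⟨R, hRpos, rfl⟩ : ∃ R > 0, R₀ = 4 * R := ⟨R₀ / 4, by positivity, by ring⟩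
  -- A good point `y'` within `R` of `y` has the ball of radius `3 * R` in `D`, while the `R`-ball
  -- about `y` lies within `2 * R` of `y'`. The gap between these radii keeps the barrier strictly
  -- positive there.
  obtain ⟨y', ⟨κ, hκ, s₀, hs₀, h⟩, hyy'⟩ := Metric.mem_closure_iff.1 hyA R hRpos
  set s := min (s₀ / 2) (R / 2) with hs
  have hspos : 0 < s := lt_min (by positivity) (by positivity)
  have hs1 : s ≤ s₀ / 2 := min_le_left _ _
  have hs2 : s ≤ R / 2 := min_le_right _ _
  set a : ℝ := d / s ^ 2 with ha
  have hapos : 0 < a := by positivity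
  have hexp : ∀ {q q' : ℝ}, 0 ≤ q → q ≤ q' → Real.exp (-a * q' ^ 2) ≤ Real.exp (-a * q ^ 2) := by
    intro q q' hq hqq'
    apply Real.exp_le_exp.2
    have : q ^ 2 ≤ q' ^ 2 := by gcongr
    nlinarith
  have hb : 0 < Real.exp (-a * (2 * R) ^ 2) - Real.exp (-a * (3 * R) ^ 2) := by
    apply sub_pos.2
    apply Real.exp_lt_exp.2
    have : 0 < a * R ^ 2 := by positivity
    nlinarith
  have hb1 : Real.exp (-a * (2 * R) ^ 2) - Real.exp (-a * (3 * R) ^ 2) ≤ 1 := by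
    have h1 : Real.exp (-a * (2 * R) ^ 2) ≤ 1 := Real.exp_le_one_iff.2 (by
      have : 0 < a * R ^ 2 := by positivity
      nlinarith)
    linarith [Real.exp_pos (-a * (3 * R) ^ 2)]
  refine ⟨κ * (Real.exp (-a * (2 * R) ^ 2) - Real.exp (-a * (3 * R) ^ 2)), by positivity, R, hRpos,
    fun u hu c hc hcu w hw => ?_⟩
  have hball : ball y' (3 * R) ⊆ D := fun v hv => hR (by
    rw [mem_ball] at *
    linarith [dist_triangle v y' y, dist_comm y y'])
  have hin : ∀ v ∈ closedBall y' s, u v ≤ -(κ * c) := fun v hv => h u hu c hc hcu v (by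
    rw [mem_closedBall] at hv
    rw [mem_ball]
    linarith)
  have hw2 : ‖w - y'‖ ≤ 2 * R := by
    rw [← dist_eq_norm]
    rw [mem_ball] at hw
    linarith [dist_triangle w y y']
  have hκc : 0 < κ * c := by positivity
  rcases le_total ‖w - y'‖ s with hws | hws
  · have h1 := hin w (by rwa [mem_closedBall, dist_eq_norm])
    nlinarith
  · have h1 := hu.le_barrier hspos (by linarith) hball hκc hin hws (by linarith)
    have h2 := hexp (norm_nonneg (w - y')) hw2
    rw [← ha] at h1
    nlinarith

/-- Compactness is used twice: over targets in `T` for a fixed source ball, then over centres in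
`S`. Halving the source radius makes one estimate at `p` serve all centres within `ρ / 2` of it. -/
theorem exists_spread_compact [NeZero d] (hD : IsOpen D) (hconn : IsPreconnected D) {S T : Set (E d)}
    (hS : IsCompact S) (hSD : S ⊆ D) (hT : IsCompact T) (hTD : T ⊆ D) {ρ : ℝ} (hρ : 0 < ρ) :
    ∃ κ > 0, ∀ p ∈ S, ∀ u, IsNonposSubharmonic D u → ∀ c > 0,
      (∀ w ∈ closedBall p ρ, u w ≤ -c) → ∀ w ∈ T, u w ≤ -(κ * c) := by
  have hmin : ∀ {a b c : ℝ}, 0 < c → min a b * c ≤ a * c ∧ min a b * c ≤ b * c := fun hc =>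
    ⟨mul_le_mul_of_nonneg_right (min_le_left _ _) hc.le,
      mul_le_mul_of_nonneg_right (min_le_right _ _) hc.le⟩
  have one : ∀ p ∈ D, ∀ r > 0, ∃ κ > 0, ∀ u, IsNonposSubharmonic D u → ∀ c > 0,
      (∀ w ∈ closedBall p r, u w ≤ -c) → ∀ w ∈ T, u w ≤ -(κ * c) := fun p hp r hr => by
    refine hT.induction_on (p := fun T' => ∃ κ > 0, ∀ u, IsNonposSubharmonic D u → ∀ c > 0,
      (∀ w ∈ closedBall p r, u w ≤ -c) → ∀ w ∈ T', u w ≤ -(κ * c)) ⟨1, one_pos, by simp⟩ ?_ ?_ ?_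
    · rintro s t hst ⟨κ, hκ, h⟩
      exact ⟨κ, hκ, fun u hu c hc hcu w hw => h u hu c hc hcu w (hst hw)⟩
    · rintro s t ⟨κ, hκ, h⟩ ⟨κ', hκ', h'⟩
      refine ⟨min κ κ', lt_min hκ hκ', fun u hu c hc hcu w hw => ?_⟩
      have := hmin (a := κ) (b := κ') hc
      rcases hw with hw | hw
      · linarith [h u hu c hc hcu w hw]
      · linarith [h' u hu c hc hcu w hw]
    · intro y hy
      obtain ⟨κ, hκ, s, hs, h⟩ := exists_spread hD hconn hp hr (hTD hy)
      exact ⟨ball y s, mem_nhdsWithin_of_mem_nhds (ball_mem_nhds y hs), κ, hκ, h⟩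
  refine hS.induction_on (p := fun S' => ∃ κ > 0, ∀ p ∈ S', ∀ u, IsNonposSubharmonic D u → ∀ c > 0,
      (∀ w ∈ closedBall p ρ, u w ≤ -c) → ∀ w ∈ T, u w ≤ -(κ * c)) ⟨1, one_pos, by simp⟩ ?_ ?_ ?_
  · rintro s t hst ⟨κ, hκ, h⟩
    exact ⟨κ, hκ, fun p hp => h p (hst hp)⟩
  · rintro s t ⟨κ, hκ, h⟩ ⟨κ', hκ', h'⟩
    refine ⟨min κ κ', lt_min hκ hκ', fun p hp u hu c hc hcu w hw => ?_⟩
    have := hmin (a := κ) (b := κ') hc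
    rcases hp with hp | hp
    · linarith [h p hp u hu c hc hcu w hw]
    · linarith [h' p hp u hu c hc hcu w hw]
  · intro p hp
    obtain ⟨κ, hκ, h⟩ := one p (hSD hp) (ρ / 2) (half_pos hρ)
    refine ⟨ball p (ρ / 2), mem_nhdsWithin_of_mem_nhds (ball_mem_nhds p (half_pos hρ)), κ, hκ,
      fun q hq u hu c hc hcu => h u hu c hc fun w hw => hcu w ?_⟩
    rw [mem_closedBall] at *
    rw [mem_ball] at hq
    linarith [dist_triangle w p q, dist_comm p q]

end IsNonposSubharmonic

theorem isCompact_setOf_ball_subset (hb : Bornology.IsBounded D) {ρ : ℝ} (hρ : 0 < ρ) :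
    IsCompact {x : E d | ball x ρ ⊆ D} := by
  refine Metric.isCompact_of_isClosed_isBounded ?_ (hb.subset fun x hx => hx (mem_ball_self hρ))
  have : {x : E d | ball x ρ ⊆ D} = ⋂ w ∈ Dᶜ, {x | ρ ≤ dist w x} := by
    ext x
    simp only [Set.mem_ofPred_eq, Set.mem_iInter, Set.mem_compl_iff]
    exact ⟨fun h w hw => not_lt.1 fun hlt => hw (h hlt), fun h w hw => by_contra fun hwD =>
      (h w hwD).not_gt hw⟩
  rw [this]
  exact isClosed_biInter fun w _ => isClosed_le continuous_const (by fun_prop)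

theorem toReal_le_of_enorm_le {V : Type*} [NormedAddCommGroup V] {v : V} {K : ℝ} (hK : 0 ≤ K)
    (h : ‖v‖ₑ ≤ ENNReal.ofReal K) : ‖v‖ ≤ K := by
  rwa [← ofReal_norm, ENNReal.ofReal_le_ofReal_iff hK] at h

/-! ### Geometry of the defining function -/

section Psi

variable {ψ : E d → ℝ} {K : ℝ}

theorem norm_iteratedFDeriv_le (hK : 0 < K) (h : normC31 ψ ≤ ENNReal.ofReal K) {k : ℕ} (hk : k < 4)
    (x : E d) : ‖iteratedFDeriv ℝ k ψ x‖ ≤ K := by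
  refine toReal_le_of_enorm_le hK.le (le_trans ?_ h)
  refine le_trans ?_ le_self_add
  refine le_trans (le_iSup (fun x => ‖iteratedFDeriv ℝ k ψ x‖ₑ) x) ?_
  exact Finset.single_le_sum (f := fun k => ⨆ x, ‖iteratedFDeriv ℝ k ψ x‖ₑ) (fun _ _ => zero_le)
    (Finset.mem_range.2 hk)

theorem norm_fderiv_le_of_normC31 (hK : 0 < K) (h : normC31 ψ ≤ ENNReal.ofReal K) (x : E d) :
    ‖fderiv ℝ ψ x‖ ≤ K := by
  rw [← norm_iteratedFDeriv_one]
  exact norm_iteratedFDeriv_le hK h (by norm_num) x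

theorem norm_fderiv_sub_le_of_normC31 (hK : 0 < K) (hψ : ContDiff ℝ 3 ψ)
    (h : normC31 ψ ≤ ENNReal.ofReal K) (x y : E d) :
    ‖fderiv ℝ ψ x - fderiv ℝ ψ y‖ ≤ K * ‖x - y‖ := by
  have hd : Differentiable ℝ (fderiv ℝ ψ) :=
    (hψ.fderiv_right (m := 2) (by norm_num)).differentiable (by norm_num)
  refine convex_univ.norm_image_sub_le_of_norm_fderiv_le (𝕜 := ℝ) (fun z _ => hd z) (fun z _ => ?_)
    (Set.mem_univ y) (Set.mem_univ x)
  rw [← norm_iteratedFDeriv_one, norm_iteratedFDeriv_fderiv]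
  exact norm_iteratedFDeriv_le hK h (by norm_num) z

/-- The mean value inequality for `ψ` minus its linear part, with the cruder constant `K` in place
of `K / 2`. -/
theorem taylor_le_of_normC31 (hK : 0 < K) (hψ : ContDiff ℝ 3 ψ)
    (h : normC31 ψ ≤ ENNReal.ofReal K) (x y : E d) :
    ψ x + fderiv ℝ ψ x (y - x) - K * ‖y - x‖ ^ 2 ≤ ψ y := by
  have h1 := (convex_closedBall x ‖y - x‖).norm_image_sub_le_of_norm_fderiv_le' (𝕜 := ℝ) (f := ψ)
    (φ := fderiv ℝ ψ x) (C := K * ‖y - x‖) (fun z _ => hψ.differentiable (by norm_num) z)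
    (fun z hz => ?_) (mem_closedBall_self (norm_nonneg _)) (y := y)
    (by rw [mem_closedBall, dist_eq_norm])
  · have h2 := (abs_le.1 (Real.norm_eq_abs _ ▸ h1)).1
    nlinarith
  · refine (norm_fderiv_sub_le_of_normC31 hK hψ h z x).trans ?_
    rw [mem_closedBall, dist_eq_norm] at hz
    gcongr

theorem inner_gradient_eq (x v : E d) : inner ℝ (gradient ψ x) v = fderiv ℝ ψ x v := by
  simp [gradient]

theorem fderiv_eq_inner_innerNormal {x : E d} (hx : gradient ψ x ≠ 0) (v : E d) :
    fderiv ℝ ψ x v = ‖gradient ψ x‖ * inner ℝ (innerNormal ψ x) v := by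
  rw [innerNormal, real_inner_smul_left, ← mul_assoc,
    mul_inv_cancel₀ (norm_ne_zero_iff.2 hx), one_mul, inner_gradient_eq]

theorem norm_innerNormal {x : E d} (hx : gradient ψ x ≠ 0) : ‖innerNormal ψ x‖ = 1 := by
  rw [innerNormal, norm_smul, norm_inv, norm_norm, inv_mul_cancel₀ (norm_ne_zero_iff.2 hx)]

/-- In this ball `‖y - x‖ ^ 2 < 2 * r * ⟨n, y - x⟩`; the choice of `r` makes the Taylor error `K *
‖y - x‖ ^ 2` smaller than `⟨n, y - x⟩ / K`, hence than the linear term. -/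
theorem ball_subset_setOf_pos (hK : 0 < K) (hψ : ContDiff ℝ 3 ψ) (h : normC31 ψ ≤ ENNReal.ofReal K)
    {x : E d} (hx : 0 ≤ ψ x) (hgrad : 1 / K ≤ ‖gradient ψ x‖) :
    ball (x + (1 / (2 * K ^ 2)) • innerNormal ψ x) (1 / (2 * K ^ 2)) ⊆ {y | 0 < ψ y} := by
  have hKi : 0 < 1 / K := by positivity
  have hne : gradient ψ x ≠ 0 := norm_pos_iff.1 (hKi.trans_le hgrad)
  set n := innerNormal ψ x with hn
  set r : ℝ := 1 / (2 * K ^ 2) with hr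
  have hrpos : 0 < r := by positivity
  intro y hy
  rw [mem_ball, dist_eq_norm] at hy
  have h1 : ‖y - x - r • n‖ ^ 2 < r ^ 2 := by
    have : y - x - r • n = y - (x + r • n) := by abel
    rw [this]; gcongr
  rw [norm_sub_sq_real, norm_smul, norm_innerNormal hne, mul_one, inner_smul_right,
    Real.norm_of_nonneg hrpos.le, real_inner_comm] at h1
  have h2 := taylor_le_of_normC31 hK hψ h x y
  rw [fderiv_eq_inner_innerNormal hne, ← hn] at h2
  set p : ℝ := inner ℝ n (y - x)
  have h3 : K * ‖y - x‖ ^ 2 < 1 / K * p := by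
    have h4 : ‖y - x‖ ^ 2 < 2 * r * p := by linarith
    have h5 : K * (2 * r * p) = 1 / K * p := by rw [hr]; field_simp
    rw [← h5]; gcongr
  have hp : 0 < p := by
    have : 0 < 1 / K * p := lt_of_le_of_lt (by positivity) h3
    exact pos_of_mul_pos_right this hKi.le
  have h6 : 1 / K * p ≤ ‖gradient ψ x‖ * p := by gcongr
  show 0 < ψ y
  linarith

/-- Moving from `x` in the direction of the inner normal at a boundary point `y` near `x`. -/
theorem add_le_of_near_frontier (hK : 0 < K) (hψ : ContDiff ℝ 3 ψ)
    (h : normC31 ψ ≤ ENNReal.ofReal K) {x y : E d} (hgrad : 1 / K ≤ ‖gradient ψ y‖)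
    (hxy : ‖x - y‖ ≤ 1 / (4 * K ^ 2)) {t : ℝ} (ht : 0 ≤ t) (ht' : t ≤ 1 / (4 * K ^ 2)) :
    ψ x + t / (2 * K) ≤ ψ (x + t • innerNormal ψ y) := by
  have hKi : 0 < 1 / K := by positivity
  have hne : gradient ψ y ≠ 0 := norm_pos_iff.1 (hKi.trans_le hgrad)
  set n := innerNormal ψ y with hn
  have hn1 : ‖n‖ = 1 := norm_innerNormal hne
  have h1 := taylor_le_of_normC31 hK hψ h x (x + t • n)
  rw [add_sub_cancel_left, norm_smul, hn1, mul_one, Real.norm_of_nonneg ht, map_smul,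
    smul_eq_mul] at h1
  have h2 : 1 / K ≤ fderiv ℝ ψ y n := by
    rw [fderiv_eq_inner_innerNormal hne, ← hn, real_inner_self_eq_norm_sq, hn1]
    simpa using hgrad
  have h3 : |fderiv ℝ ψ x n - fderiv ℝ ψ y n| ≤ K * (1 / (4 * K ^ 2)) := by
    rw [← _root_.sub_apply, ← Real.norm_eq_abs]
    refine (ContinuousLinearMap.le_opNorm _ _).trans ?_
    rw [hn1, mul_one]
    exact (norm_fderiv_sub_le_of_normC31 hK hψ h x y).trans (by gcongr)
  have h4 : K * (1 / (4 * K ^ 2)) = 1 / (4 * K) := by field_simp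
  have h5 : K * t ≤ 1 / (4 * K) := h4 ▸ mul_le_mul_of_nonneg_left ht' hK.le
  rw [h4] at h3
  have h6 := (abs_le.1 h3).1
  have h7 : 1 / K = 4 * (1 / (4 * K)) := by field_simp
  have h8 : t / (2 * K) = t * (2 * (1 / (4 * K))) := by field_simp; norm_num
  rw [h8]
  -- Of the slope `1 / K` at `y`, moving the base point to `x` costs `1 / (4 * K)` and the quadratic
  -- error costs as much again; half remains.
  have h9 : t * (2 * (1 / (4 * K))) ≤ t * (fderiv ℝ ψ x n - K * t) := by
    apply mul_le_mul_of_nonneg_left _ ht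
    linarith
  linarith

theorem ball_subset_setOf_pos_of_le (hK : 0 < K) (hψ : ContDiff ℝ 3 ψ)
    (h : normC31 ψ ≤ ENNReal.ofReal K) {x : E d} {η : ℝ} (hη : η ≤ ψ x) :
    ball x (η / K) ⊆ {y | 0 < ψ y} := by
  intro y hy
  have h1 := convex_univ.norm_image_sub_le_of_norm_fderiv_le (𝕜 := ℝ) (f := ψ) (C := K)
    (fun z _ => hψ.differentiable (by norm_num) z)
    (fun z _ => norm_fderiv_le_of_normC31 hK h z) (Set.mem_univ x) (Set.mem_univ y)
  rw [mem_ball, dist_eq_norm, lt_div_iff₀ hK] at hy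
  have h2 := (abs_le.1 (Real.norm_eq_abs _ ▸ h1)).1
  show 0 < ψ y
  linarith

end Psi

/-! ### A ball where the right-hand side is bounded below -/

section Source

variable {ψ g : E d → ℝ} {K : ℝ}

theorem IsControlled.norm_fderiv_le (hK : 0 < K) (hg : IsControlled K D ψ g) {x : E d}
    (hx : x ∈ D) : ‖fderiv ℝ g x‖ ≤ K := by
  refine toReal_le_of_enorm_le hK.le (le_trans ?_ hg.bound)
  refine le_trans (le_iSup₂ (f := fun x (_ : x ∈ D) => ‖fderiv ℝ g x‖ₑ) x hx) ?_
  refine le_trans (le_add_self : _ ≤ normC1 D g) ?_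
  exact (le_add_self.trans le_self_add).trans le_self_add

theorem IsControlled.normC31_le (hg : IsControlled K D ψ g) :
    normC31 ψ ≤ ENNReal.ofReal K :=
  le_add_self.trans hg.bound

/-- The supremum is at least `1 / K`; a nearly maximal point of the closure is moved into `D` by
continuity. -/
theorem IsControlled.exists_lt (hK : 0 < K) (hg : IsControlled K D ψ g) :
    ∃ x ∈ D, 1 / (2 * K) < g x := by
  have h1 : (supNorm D g)⁻¹ ≤ ENNReal.ofReal K := (le_add_self.trans le_self_add).trans hg.bound
  have h2 : ENNReal.ofReal (1 / (2 * K)) < supNorm D g := by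
    refine lt_of_lt_of_le ?_ (ENNReal.inv_le_iff_inv_le.1 h1)
    rw [← ENNReal.ofReal_inv_of_pos hK, ENNReal.ofReal_lt_ofReal_iff (by positivity), one_div]
    exact inv_strictAnti₀ hK (by linarith)
  obtain ⟨x, h3⟩ := lt_iSup_iff.1 h2
  obtain ⟨hx, h3⟩ := lt_iSup_iff.1 h3
  rw [← ofReal_norm, ENNReal.ofReal_lt_ofReal_iff_of_nonneg (by positivity), Real.norm_eq_abs,
    abs_of_nonneg (hg.nonneg x hx)] at h3
  have h4 : Tendsto g (𝓝[D] x) (𝓝 (g x)) :=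
    ((hg.smooth.continuousOn x hx).mono subset_closure)
  have : (𝓝[D] x).NeBot := mem_closure_iff_nhdsWithin_neBot.1 hx
  obtain ⟨y, hy, hyD⟩ := ((h4.eventually (lt_mem_nhds h3)).and self_mem_nhdsWithin).exists
  exact ⟨y, hyD, hy⟩

theorem IsControlled.le_of_segment_subset (hK : 0 < K) (hD : IsOpen D) (hg : IsControlled K D ψ g)
    {x y : E d} (hxy : segment ℝ x y ⊆ D) : g x - K * ‖y - x‖ ≤ g y := by
  have h1 := (convex_segment x y).norm_image_sub_le_of_norm_fderiv_le (𝕜 := ℝ) (f := g) (C := K)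
    (fun z hz => (hg.smooth.contDiffAt (mem_of_superset (hD.mem_nhds (hxy hz))
      subset_closure)).differentiableAt (by norm_num))
    (fun z hz => hg.norm_fderiv_le hK (hxy hz)) (left_mem_segment ℝ x y) (right_mem_segment ℝ x y)
  have h2 := (abs_le.1 (Real.norm_eq_abs _ ▸ h1)).1
  linarith

/-- There is a ball in `D`, of radius controlled by `K`, on which `g` is bounded below. -/
theorem exists_ball_le {m : ℕ} (hK : 0 < K) (hdom : IsConvexDomain m K D ψ)
    (hg : IsControlled K D ψ g) {ρ : ℝ} (hρ1 : ρ ≤ 1 / (16 * K ^ 2))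
    (hρ2 : ρ ≤ 1 / (32 * K ^ 4)) :
    ∃ x, ball x ρ ⊆ D ∧ ∀ y ∈ ball x ρ, 1 / (4 * K) ≤ g y := by
  have hψ := hdom.smooth
  have hn := hg.normC31_le
  have hD : IsOpen D := by
    rw [hdom.eq_pos]; exact isOpen_lt continuous_const hψ.continuous
  have hKK : K * (1 / (16 * K ^ 2)) = 1 / (16 * K) := by field_simp
  obtain ⟨x, hxD, hgx⟩ := hg.exists_lt hK
  have key : ∃ x', ball x' ρ ⊆ D ∧ segment ℝ x x' ⊆ D ∧ ‖x' - x‖ ≤ 1 / (16 * K ^ 2) := by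
    -- Otherwise `x` is near the boundary and is pushed inward by `1 / (16 * K ^ 2)` along the
    -- normal at a nearest boundary point. Then `ψ` grows along the path, which stays in `D`, and
    -- gains `1 / (32 * K ^ 3)`, leaving room for a ball of radius `1 / (32 * K ^ 4)`.
    by_cases hxb : ball x ρ ⊆ D
    · exact ⟨x, hxb, by simpa using hxD, by simp; positivity⟩
    obtain ⟨w, hw, hwD⟩ := Set.not_subset.1 hxb
    have hDne : D ≠ Set.univ := fun h => hwD (h ▸ Set.mem_univ w)
    obtain ⟨y, hy, hxy⟩ := exists_mem_frontier_infDist_compl_eq_dist hxD hDne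
    have hxy' : ‖x - y‖ ≤ 1 / (4 * K ^ 2) := by
      rw [← dist_eq_norm, ← hxy]
      refine (infDist_le_dist_of_mem (Set.mem_compl hwD)).trans ?_
      rw [mem_ball, dist_comm] at hw
      refine (hw.le.trans hρ1).trans ?_
      gcongr
      norm_num
    have hmove := fun {t : ℝ} => add_le_of_near_frontier (t := t) hK hψ hn
      (hdom.norm_gradient y hy) hxy'
    have h16 : 1 / (16 * K ^ 2) ≤ 1 / (4 * K ^ 2) := by gcongr; norm_num
    have hne : gradient ψ y ≠ 0 := norm_pos_iff.1
      ((by positivity : 0 < 1 / K).trans_le (hdom.norm_gradient y hy))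
    have hxpos : 0 < ψ x := by rw [hdom.eq_pos] at hxD; exact hxD
    refine ⟨x + (1 / (16 * K ^ 2)) • innerNormal ψ y, ?_, ?_, ?_⟩
    · have h1 := hmove (by positivity) h16
      have h2 := ball_subset_setOf_pos_of_le hK hψ hn (η := 1 / (16 * K ^ 2) / (2 * K))
        (by linarith)
      rw [← hdom.eq_pos] at h2
      refine (ball_subset_ball ?_).trans h2
      refine hρ2.trans (le_of_eq ?_)
      field_simp
      norm_num
    · rw [segment_eq_image']
      rintro _ ⟨θ, hθ, rfl⟩
      rw [hdom.eq_pos]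
      show 0 < ψ (x + θ • (x + (1 / (16 * K ^ 2)) • innerNormal ψ y - x))
      rw [add_sub_cancel_left, smul_smul]
      have h0 : 0 ≤ θ * (1 / (16 * K ^ 2)) := mul_nonneg hθ.1 (by positivity)
      have h1 := hmove h0 ((mul_le_of_le_one_left (by positivity) hθ.2).trans h16)
      have : 0 ≤ θ * (1 / (16 * K ^ 2)) / (2 * K) := by positivity
      linarith
    · rw [add_sub_cancel_left, norm_smul, norm_innerNormal hne, mul_one,
        Real.norm_of_nonneg (by positivity)]
  obtain ⟨x', hb, hseg, hdist⟩ := key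
  refine ⟨x', hb, fun y hy => ?_⟩
  have hρ : 0 < ρ := pos_of_mem_ball hy
  have h1 := hg.le_of_segment_subset hK hD hseg
  have h2 := hg.le_of_segment_subset hK hD
    (((convex_ball x' ρ).segment_subset (mem_ball_self hρ) hy).trans hb)
  rw [mem_ball, dist_eq_norm] at hy
  -- The two moves, `x` to `x'` and `x'` to `y`, each cost `g` at most `1 / (16 * K)`, starting from
  -- `1 / (2 * K)`.
  have h3 : K * ‖x' - x‖ ≤ 1 / (16 * K) := hKK ▸ mul_le_mul_of_nonneg_left hdist hK.le
  have h4 : K * ‖y - x'‖ ≤ 1 / (16 * K) :=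
    hKK ▸ mul_le_mul_of_nonneg_left (hy.le.trans hρ1) hK.le
  have h5 : 1 / (2 * K) = 8 * (1 / (16 * K)) := by field_simp; norm_num
  have h6 : 1 / (4 * K) = 4 * (1 / (16 * K)) := by field_simp; norm_num
  have h7 : 0 < 1 / (16 * K) := by positivity
  linarith

end Source

end MHessian

/-! ### The boundary estimate -/

open MHessian in
theorem lemma4p3 (d : ℕ) (D : Set (E d)) (K : ℝ) (hK : 0 < K) :
    ∃ γ : ℝ, 0 < γ ∧
      ∀ m : ℕ, 2 ≤ m → m ≤ d →
      ∀ ψ g u : E d → ℝ,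
        IsConvexDomain m K D ψ →
        IsControlled K D ψ g →
        ContDiffOn ℝ 1 u (closure D) →
        IsAdmissible m D u →
        (∀ x ∈ D, P m (hessian u x) = g x ^ (m - 1)) →
        (∀ x ∈ frontier D, u x = 0) →
        ∀ x ∈ frontier D,
          fderivWithin ℝ u (closure D) x (innerNormal ψ x) ≤ -γ := by
  -- The constant is chosen before `ψ` and `m`, so the needed properties are tested on `d` and `D`
  -- alone; if one fails, the claim is vacuous.
  by_cases hdom : 2 ≤ d ∧ IsOpen D ∧ IsPreconnected D ∧ Bornology.IsBounded D
  swap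
  · refine ⟨1, one_pos, fun m h2 hm ψ g u hψ => absurd ⟨h2.trans hm, ?_, hψ.connected.isPreconnected,
      hψ.bounded⟩ hdom⟩
    rw [hψ.eq_pos]
    exact isOpen_lt continuous_const hψ.smooth.continuous
  obtain ⟨hd2, hD, hconn, hb⟩ := hdom
  have : NeZero d := ⟨by omega⟩
  have hdpos : (0 : ℝ) < d := by exact_mod_cast (by omega : 0 < d)
  set ρ : ℝ := min (1 / (16 * K ^ 2)) (1 / (32 * K ^ 4)) with hρ
  have hρpos : 0 < ρ := lt_min (by positivity) (by positivity)
  set r : ℝ := 1 / (2 * K ^ 2) with hr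
  have hrpos : 0 < r := by positivity
  set a : ℝ := min 1 (1 / (4 * K)) with ha
  have hapos : 0 < a := lt_min one_pos (by positivity)
  set θ : ℝ := a ^ d / 2 ^ d with hθ
  have hθpos : 0 < θ := by positivity
  have hsub : ∀ {s : ℝ}, 0 < s → {x : E d | Metric.ball x s ⊆ D} ⊆ D := fun hs x hx =>
    hx (Metric.mem_ball_self hs)
  -- The source centre depends on `g`, hence the compact set of all possible centres. The targets
  -- include every inner half of an interior ball of radius `r`, where the Hopf lemma needs its
  -- bound.
  obtain ⟨κ, hκ, hspread⟩ := IsNonposSubharmonic.exists_spread_compact hD hconn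
    (isCompact_setOf_ball_subset hb hρpos) (hsub hρpos)
    (isCompact_setOf_ball_subset hb (half_pos hrpos)) (hsub (half_pos hrpos)) (half_pos hρpos)
  -- The depth of the paraboloid on the sphere of radius `ρ / 2`, its least depth on the half ball.
  set c : ℝ := θ / (4 * d) * (ρ ^ 2 - (ρ / 2) ^ 2) with hc
  have hcpos : 0 < c := by
    have : 0 < ρ ^ 2 - (ρ / 2) ^ 2 := by nlinarith [sq_pos_of_pos hρpos]
    positivity
  refine ⟨κ * c * (Real.exp (-(d / (r / 2) ^ 2) * r ^ 2) * (d / (r / 2) ^ 2 * (2 * r))),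
    by positivity, fun m h2 hmd ψ g u hψ hg hu hadm heq hbd x hx => ?_⟩
  have h1m : 1 ≤ m := by omega
  have hns : IsNonposSubharmonic D u := isNonposSubharmonic_of_frontier hD hb hu.continuousOn hadm.1
    (fun y hy => trace_nonneg_of_mem_closure_gardingCone h1m hmd (hadm.2 y hy)) hbd
  obtain ⟨p, hpb, hp⟩ := exists_ball_le hK hψ hg (ρ := ρ) (min_le_left _ _) (min_le_right _ _)
  have hsource : ∀ w ∈ Metric.closedBall p (ρ / 2), u w ≤ -c := fun w hw => by
    have h3 := hns.le_paraboloid hρpos hpb hθpos (fun y hy => ?_)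
      (Metric.closedBall_subset_closedBall (by linarith) hw)
    · rw [Metric.mem_closedBall, dist_eq_norm] at hw
      refine h3.trans (neg_le_neg ?_)
      rw [hc]
      gcongr
    · refine le_trace_of_pow_le h1m hmd hapos (min_le_left _ _) (hadm.2 y (hpb hy)) ?_
      rw [heq y (hpb hy)]
      exact pow_le_pow_left₀ hapos.le ((min_le_right _ _).trans (hp y hy)) _
  have hdeep := hspread p hpb u hns c hcpos hsource
  have hψx : 0 ≤ ψ x := by
    have hcl : IsClosed {y | 0 ≤ ψ y} := isClosed_le continuous_const hψ.smooth.continuous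
    refine closure_minimal (fun y hy => ?_) hcl (frontier_subset_closure hx)
    rw [hψ.eq_pos] at hy
    exact le_of_lt (show 0 < ψ y from hy)
  have hgrad := hψ.norm_gradient x hx
  have hne : gradient ψ x ≠ 0 := norm_pos_iff.1 ((by positivity : 0 < 1 / K).trans_le hgrad)
  have hball : Metric.ball (x + r • innerNormal ψ x) r ⊆ D := by
    have := ball_subset_setOf_pos hK hψ.smooth hg.normC31_le hψx hgrad
    rwa [← hψ.eq_pos] at this
  refine hns.fderivWithin_le hrpos (norm_innerNormal hne) hball (by positivity)
    (fun y hy => hdeep y fun w hw => hball ?_) (hbd x hx)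
    ((hu.differentiableOn (by norm_num)) x (frontier_subset_closure hx))
  rw [Metric.mem_ball] at *
  rw [Metric.mem_closedBall] at hy
  linarith [dist_triangle w y (x + r • innerNormal ψ x)]
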